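/- Let $\mathcal L$ be a finite set and let $Z=(Z_n)_{n\ge 0}$ be an irreducible, aperiodic Markov chain on $\mathcal L$ with transition matrix $Q$ and initial distribution $\mu$, an arbitrary probability distribution on $\mathcal L$; write $E^Q_\mu$ for the corresponding expectation. Let $\varphi:\mathcal L\to(0,\infty)$, and for $n\ge 0$ let $Q_n$ be the probability measure on $\sigma(Z_0,\dots,Z_n)$ given by $$Q_n(A)=\frac{E^Q_\mu\big(\mathbf 1_A/\varphi(Z_n)\big)}{E^Q_\mu\big(1/\varphi(Z_n)\big)},\qquad A\in\sigma(Z_0,\dots,Z_n).$$ Let $\pi$ be the stationary distribution of $Q$ and, for a function $g$ on $\mathcal L$, put $E_\pi g=\sum_{z}\pi(z)g(z)$, $\tilde g=g-E_\pi g$ and $\tilde S_n=\sum_{j=0}^n\tilde g(Z_j)$. Let $Q^\#$ be the group inverse, i.e. the linear operator on functions on $\mathcal L$ which is the inverse of $I-Q$ on the invariant subspace $\{h:E_\pi h=0\}$ and satisfies $Q^\#\mathbf 1=0$. 1. (Weak law of large numbers.) For every $g:\mathcal L\to\mathbb C$ and every $\epsilon>0$, $$\lim_{n\to\infty}Q_n\left(\left|\frac{\tilde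 S_n}{n+1}\right|>\epsilon\right)=0.$$ 2. (Central limit theorem.) For every $g:\mathcal L\to\mathbb R$, the number $$\sigma^2=E_\pi\big[\tilde g\,\big((2Q^\#-I)\tilde g\big)\big]$$ is nonnegative, and the law of $\tilde S_n/\sqrt{n+1}$ under $Q_n$ converges weakly, as $n\to\infty$, to the normal distribution $N(0,\sigma^2)$ (the point mass at $0$ if $\sigma^2=0$). -/

import Mathlib

open MeasureTheory ProbabilityTheory Filter
open scoped Topology Matrix ENNReal

namespace FiniteChain

section Stationary

/-- Aperiodicity of a transition matrix: for every state `z`, the greatest common divisor of the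
return times `{k ≥ 1 : Q ^ k (z, z) > 0}` equals `1`. -/
def IsAperiodic {L : Type*} [Fintype L] [DecidableEq L] (Q : Matrix L L ℝ) : Prop :=
  ∀ z : L, ∀ d : ℕ, (∀ k : ℕ, 0 < k → 0 < (Q ^ k) z z → d ∣ k) → d = 1

/-- `π` is a stationary distribution of `Q`: a probability vector with `π Q = π`. -/
structure IsStationary {L : Type*} [Fintype L] (Q : Matrix L L ℝ) (π : L → ℝ) : Prop where
  mem_stdSimplex : π ∈ stdSimplex ℝ L
  vecMul_eq : π ᵥ* Q = π

variable {L : Type*} [Fintype L] [DecidableEq L]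

theorem vecMul_abs_eq {Q : Matrix L L ℝ} (hQ : Q ∈ Matrix.rowStochastic ℝ L) {v : L → ℝ}
    (hv : v ᵥ* Q = v) : |v| ᵥ* Q = |v| := by
  have hle : ∀ z ∈ Finset.univ, |v| z ≤ (|v| ᵥ* Q) z := by
    intro z _
    conv_lhs => rw [← hv]
    simp only [Pi.abs_apply, Matrix.vecMul, dotProduct]
    refine (Finset.abs_sum_le_sum_abs _ _).trans (le_of_eq ?_)
    exact Finset.sum_congr rfl fun i _ => by rw [abs_mul, abs_of_nonneg (hQ.1 i z)]
  have hsum : ∑ z, |v| z = ∑ z, (|v| ᵥ* Q) z := by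
    simp only [Matrix.vecMul, dotProduct]
    rw [Finset.sum_comm]
    refine Finset.sum_congr rfl fun i _ => ?_
    rw [← Finset.mul_sum, Matrix.sum_row_of_mem_rowStochastic hQ, mul_one]
  funext z
  exact ((Finset.sum_eq_sum_iff_of_le hle).1 hsum z (Finset.mem_univ z)).symm

theorem exists_isStationary [Nonempty L] {Q : Matrix L L ℝ}
    (hQ : Q ∈ Matrix.rowStochastic ℝ L) : ∃ π : L → ℝ, IsStationary Q π := by
  have h1 : ∃ v : L → ℝ, v ≠ 0 ∧ (Q - 1) *ᵥ v = 0 :=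
    ⟨1, one_ne_zero, by rw [Matrix.sub_mulVec, hQ.2, Matrix.one_mulVec, sub_self]⟩
  obtain ⟨v, hv0, hv⟩ :=
    Matrix.exists_vecMul_eq_zero_iff.2 (Matrix.exists_mulVec_eq_zero_iff.1 h1)
  rw [Matrix.vecMul_sub, Matrix.vecMul_one, sub_eq_zero] at hv
  have ha := vecMul_abs_eq hQ hv
  have hpos : 0 < ∑ z, |v| z := by
    obtain ⟨z, hz⟩ := Function.ne_iff.1 hv0
    exact Finset.sum_pos' (fun i _ => abs_nonneg (v i)) ⟨z, Finset.mem_univ z, abs_pos.2 hz⟩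
  refine ⟨(∑ z, |v| z)⁻¹ • |v|, ⟨fun z => ?_, ?_⟩, ?_⟩
  · exact mul_nonneg (inv_nonneg.2 hpos.le) (abs_nonneg (v z))
  · simp only [Pi.smul_apply, smul_eq_mul, ← Finset.mul_sum]
    exact inv_mul_cancel₀ hpos.ne'
  · rw [Matrix.smul_vecMul, ha]

theorem vecMul_pow_eq {Q : Matrix L L ℝ} {v : L → ℝ} (hv : v ᵥ* Q = v) (k : ℕ) :
    v ᵥ* Q ^ k = v := by
  induction k with
  | zero => simp
  | succ k ih => rw [pow_succ, ← Matrix.vecMul_vecMul, ih, hv]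

/-- A nonnegative nonzero invariant vector of an irreducible matrix is positive. -/
theorem pos_of_vecMul_eq {Q : Matrix L L ℝ} (hQ : Q ∈ Matrix.rowStochastic ℝ L)
    (hirr : Q.IsIrreducible) {v : L → ℝ} (hv : v ᵥ* Q = v) (h0 : ∀ z, 0 ≤ v z) {y : L}
    (hy : 0 < v y) (z : L) : 0 < v z := by
  obtain ⟨k, -, hk⟩ := (Matrix.isIrreducible_iff_exists_pow_pos hQ.1).1 hirr y z
  rw [← vecMul_pow_eq hv k]
  have hQk : Q ^ k ∈ Matrix.rowStochastic ℝ L := pow_mem hQ k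
  exact Finset.sum_pos' (fun i _ => mul_nonneg (h0 i) (hQk.1 i z))
    ⟨y, Finset.mem_univ y, mul_pos hy hk⟩

/-- An irreducible chain has only one stationary distribution. -/
theorem IsStationary.eq {Q : Matrix L L ℝ} (hQ : Q ∈ Matrix.rowStochastic ℝ L)
    (hirr : Q.IsIrreducible) {π π' : L → ℝ} (h : IsStationary Q π) (h' : IsStationary Q π') :
    π = π' := by
  set v : L → ℝ := π - π' with hvdef
  have hv : v ᵥ* Q = v := by rw [hvdef, Matrix.sub_vecMul, h.vecMul_eq, h'.vecMul_eq]
  have hsum : ∑ z, v z = 0 := by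
    simp only [hvdef, Pi.sub_apply, Finset.sum_sub_distrib]
    rw [h.mem_stdSimplex.2, h'.mem_stdSimplex.2, sub_self]
  have ha := vecMul_abs_eq hQ hv
  have hp : (|v| + v) ᵥ* Q = |v| + v := by rw [Matrix.add_vecMul, ha, hv]
  have hp0 : ∀ z, 0 ≤ (|v| + v) z := fun z => by
    have := neg_abs_le (v z)
    simp only [Pi.add_apply, Pi.abs_apply]
    linarith
  by_cases hall : ∀ z, v z ≤ 0
  · have := (Finset.sum_eq_zero_iff_of_nonpos fun z _ => hall z).1 hsum
    funext z
    exact sub_eq_zero.1 (this z (Finset.mem_univ z))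
  · exfalso
    push Not at hall
    obtain ⟨y, hy⟩ := hall
    have hy' : 0 < (|v| + v) y := add_pos (abs_pos.2 hy.ne') hy
    have hpos : ∀ z, 0 < v z := fun z => by
      have h1 := pos_of_vecMul_eq hQ hirr hp hp0 hy' z
      by_contra hz
      push Not at hz
      simp [abs_of_nonpos hz] at h1
    have : 0 < ∑ z, v z := Finset.sum_pos (fun z _ => hpos z) ⟨y, Finset.mem_univ y⟩
    exact this.ne' hsum

/-- The stationary distribution `π^Q` of a stochastic matrix `Q`
(unique if `Q` is irreducible, see `IsStationary.eq`). -/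
noncomputable def stationaryDist [Nonempty L] {Q : Matrix L L ℝ}
    (hQ : Q ∈ Matrix.rowStochastic ℝ L) : L → ℝ :=
  (exists_isStationary hQ).choose

theorem isStationary_stationaryDist [Nonempty L] {Q : Matrix L L ℝ}
    (hQ : Q ∈ Matrix.rowStochastic ℝ L) : IsStationary Q (stationaryDist hQ) :=
  (exists_isStationary hQ).choose_spec

end Stationary

section GroupInverse

/-- The expectation `E_π g = ∑ z, π z * g z` of a real- or complex-valued function on the finite
state space, as a linear map. -/
def expect {L : Type*} [Fintype L] {E : Type*} [AddCommGroup E] [Module ℝ E] (π : L → ℝ) :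
    (L → E) →ₗ[ℝ] E where
  toFun g := ∑ z, π z • g z
  map_add' g h := by simp [smul_add, Finset.sum_add_distrib]
  map_smul' c g := by
    simp only [Pi.smul_apply, RingHom.id_apply, Finset.smul_sum]
    exact Finset.sum_congr rfl fun z _ => smul_comm _ _ _

/-- The centered function `g - E_π g`. -/
def centered {L : Type*} [Fintype L] {E : Type*} [AddCommGroup E] [Module ℝ E] (π : L → ℝ)
    (g : L → E) : L → E :=
  fun z => g z - expect π g

variable {L : Type*} [Fintype L] [DecidableEq L]

theorem expect_centered {E : Type*} [AddCommGroup E] [Module ℝ E] {π : L → ℝ}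
    (hπ : π ∈ stdSimplex ℝ L) (g : L → E) : expect π (centered π g) = 0 := by
  have h : expect π (centered π g) = expect π g - ∑ z, π z • expect π g := by
    change ∑ z, π z • (g z - expect π g) = ∑ z, π z • g z - ∑ z, π z • expect π g
    simp only [smul_sub, Finset.sum_sub_distrib]
  rw [h, ← Finset.sum_smul, hπ.2, one_smul, sub_self]

/-- The subspace `V = {g : E_π g = 0}` of centered functions. -/
abbrev centeredSpace (π : L → ℝ) : Submodule ℝ (L → ℝ) :=
  LinearMap.ker (expect (E := ℝ) π)

theorem one_sub_mapsTo_centeredSpace {Q : Matrix L L ℝ} {π : L → ℝ} (hπ : IsStationary Q π) :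
    ∀ g ∈ centeredSpace π, (1 - Q).mulVecLin g ∈ centeredSpace π := by
  intro g hg
  have he : ∀ h : L → ℝ, expect π h = π ⬝ᵥ h := fun h => rfl
  rw [LinearMap.mem_ker, he] at hg ⊢
  rw [Matrix.mulVecLin_apply, Matrix.dotProduct_mulVec, Matrix.vecMul_sub, Matrix.vecMul_one,
    hπ.vecMul_eq, sub_self, zero_dotProduct]

/-- The restriction of `I - Q` to the invariant subspace `V`. -/
def oneSubRestrict {Q : Matrix L L ℝ} {π : L → ℝ} (hπ : IsStationary Q π) :
    Module.End ℝ (centeredSpace π) :=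
  (1 - Q).mulVecLin.restrict (one_sub_mapsTo_centeredSpace hπ)

/-- The projection `g ↦ g - E_π g` onto `V` (its kernel is the line of constants). -/
def toCentered {π : L → ℝ} (hπ : π ∈ stdSimplex ℝ L) : (L → ℝ) →ₗ[ℝ] centeredSpace π where
  toFun g := ⟨centered π g, expect_centered hπ g⟩
  map_add' g h := by
    ext z
    simp [centered]
    ring
  map_smul' c g := by
    ext z
    simp [centered, mul_sub]

/-- For irreducible `Q`, the operator `I - Q` is invertible on `V`. -/
theorem isUnit_oneSubRestrict [Nonempty L] {Q : Matrix L L ℝ}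
    (hQ : Q ∈ Matrix.rowStochastic ℝ L) (hirr : Q.IsIrreducible) {π : L → ℝ}
    (hπ : IsStationary Q π) : IsUnit (oneSubRestrict hπ) := by
  rw [LinearMap.isUnit_iff_ker_eq_bot, LinearMap.ker_eq_bot']
  rintro ⟨h, hh⟩ h0
  have hfix : Q *ᵥ h = h := by
    have := congrArg Subtype.val h0
    simp only [oneSubRestrict, LinearMap.coe_restrict_apply, Matrix.mulVecLin_apply,
      Matrix.sub_mulVec, Matrix.one_mulVec, ZeroMemClass.coe_zero] at this
    exact (sub_eq_zero.1 this).symm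
  have hfixk : ∀ k : ℕ, (Q ^ k) *ᵥ h = h := by
    intro k
    induction k with
    | zero => simp
    | succ k ih => rw [pow_succ, ← Matrix.mulVec_mulVec, hfix, ih]
  obtain ⟨y, hy⟩ := Finite.exists_max h
  have hconst : ∀ z, h z = h y := by
    intro z
    obtain ⟨k, -, hk⟩ := (Matrix.isIrreducible_iff_exists_pow_pos hQ.1).1 hirr y z
    have hQk : Q ^ k ∈ Matrix.rowStochastic ℝ L := pow_mem hQ k
    have hs : ∑ x, (Q ^ k) y x * (h y - h x) = 0 := by
      simp only [mul_sub, Finset.sum_sub_distrib, ← Finset.sum_mul]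
      rw [Matrix.sum_row_of_mem_rowStochastic hQk, one_mul, sub_eq_zero]
      exact (congrFun (hfixk k) y).symm
    have := (Finset.sum_eq_zero_iff_of_nonneg
      (fun x _ => mul_nonneg (hQk.1 y x) (sub_nonneg.2 (hy x)))).1 hs z (Finset.mem_univ z)
    rcases mul_eq_zero.1 this with h1 | h1
    · exact absurd h1 hk.ne'
    · linarith
  have hz : h y = 0 := by
    have he : ∑ z, π z * h z = 0 := hh
    simp only [hconst, ← Finset.sum_mul] at he
    rwa [hπ.mem_stdSimplex.2, one_mul] at he
  ext z
  simp [hconst z, hz]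

/-- The group inverse `Q^#`: the inverse of `I - Q` on `V`, extended to all functions linearly
by `Q^# 1 = 0`. -/
noncomputable def groupInverse [Nonempty L] {Q : Matrix L L ℝ}
    (hQ : Q ∈ Matrix.rowStochastic ℝ L) : (L → ℝ) →ₗ[ℝ] (L → ℝ) :=
  (centeredSpace (stationaryDist hQ)).subtype ∘ₗ
    Ring.inverse (oneSubRestrict (isStationary_stationaryDist hQ)) ∘ₗ
      toCentered (isStationary_stationaryDist hQ).mem_stdSimplex

theorem groupInverse_one [Nonempty L] {Q : Matrix L L ℝ}
    (hQ : Q ∈ Matrix.rowStochastic ℝ L) : groupInverse hQ 1 = 0 := by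
  have h := (isStationary_stationaryDist hQ).mem_stdSimplex
  have h1 : toCentered h 1 = 0 := by
    ext z
    change (1 : ℝ) - ∑ x, stationaryDist hQ x • (1 : ℝ) = 0
    simp [h.2]
  simp [groupInverse, h1]

theorem one_sub_mulVec_groupInverse [Nonempty L] {Q : Matrix L L ℝ}
    (hQ : Q ∈ Matrix.rowStochastic ℝ L) (hirr : Q.IsIrreducible) (g : L → ℝ) :
    (1 - Q) *ᵥ groupInverse hQ g = centered (stationaryDist hQ) g := by
  have hπ := isStationary_stationaryDist hQ
  have hu := Ring.mul_inverse_cancel _ (isUnit_oneSubRestrict hQ hirr hπ)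
  exact congrArg Subtype.val (LinearMap.congr_fun hu (toCentered hπ.mem_stdSimplex g))

theorem expect_groupInverse [Nonempty L] {Q : Matrix L L ℝ}
    (hQ : Q ∈ Matrix.rowStochastic ℝ L) (g : L → ℝ) :
    expect (stationaryDist hQ) (groupInverse hQ g) = 0 :=
  (Ring.inverse (oneSubRestrict (isStationary_stationaryDist hQ))
    (toCentered (isStationary_stationaryDist hQ).mem_stdSimplex g)).2

/-- `σ² = E_π [g̃ · ((2 Q^# - I) g̃)]`, with `g̃ = g - E_π g` and `π` the stationary distribution. -/
noncomputable def asymptoticVariance [Nonempty L] {Q : Matrix L L ℝ}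
    (hQ : Q ∈ Matrix.rowStochastic ℝ L) (g : L → ℝ) : ℝ :=
  let gt : L → ℝ := centered (stationaryDist hQ) g
  expect (stationaryDist hQ) (gt * (2 • groupInverse hQ gt - gt))

end GroupInverse

section Chain

/-- Under `P`, the process `Z` is a Markov chain on the finite set `L` with initial distribution
`μ` and transition function `Q`. -/
structure IsMarkovChain {L : Type*} [MeasurableSpace L] {Ω : Type*} [MeasurableSpace Ω]
    (P : Measure Ω) (Z : ℕ → Ω → L) (μ : L → ℝ) (Q : Matrix L L ℝ) : Prop where
  measurable : ∀ n, Measurable (Z n)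
  law : ∀ (n : ℕ) (z : ℕ → L), P {ω | ∀ j ≤ n, Z j ω = z j} =
    ENNReal.ofReal (μ (z 0) * ∏ j ∈ Finset.range n, Q (z j) (z (j + 1)))

/-- The measure `Q_n(A) = E[1_A / φ(Z_n)] / E[1 / φ(Z_n)]`. It is given here on all events `A`
of the underlying space; on `σ(Z_0, …, Z_n)` it is the tilted measure `Q_n`. -/
noncomputable def tiltedMeasure {L : Type*} {Ω : Type*} [MeasurableSpace Ω]
    (P : Measure Ω) (Z : ℕ → Ω → L) (φ : L → Set.Ioi (0 : ℝ)) (n : ℕ) : Measure Ω :=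
  (∫⁻ ω, ENNReal.ofReal (1 / (φ (Z n ω) : ℝ)) ∂P)⁻¹ •
    P.withDensity fun ω => ENNReal.ofReal (1 / (φ (Z n ω) : ℝ))

instance {L : Type*} [Finite L] {Ω : Type*} [MeasurableSpace Ω] (P : Measure Ω)
    [IsProbabilityMeasure P] (Z : ℕ → Ω → L) (φ : L → Set.Ioi (0 : ℝ)) (n : ℕ) :
    IsProbabilityMeasure (tiltedMeasure P Z φ n) := by
  have hΩ : Nonempty Ω := nonempty_of_isProbabilityMeasure P
  have hL : Nonempty L := hΩ.map (Z n)
  have hpos : ∀ z, 0 < 1 / (φ z : ℝ) := fun z => one_div_pos.2 (φ z).2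
  obtain ⟨a, ha⟩ := Finite.exists_min fun z => 1 / (φ z : ℝ)
  obtain ⟨b, hb⟩ := Finite.exists_max fun z => 1 / (φ z : ℝ)
  have hlow : ENNReal.ofReal (1 / (φ a : ℝ)) ≤ ∫⁻ ω, ENNReal.ofReal (1 / (φ (Z n ω) : ℝ)) ∂P := by
    calc ENNReal.ofReal (1 / (φ a : ℝ)) = ∫⁻ _, ENNReal.ofReal (1 / (φ a : ℝ)) ∂P := by simp
      _ ≤ _ := lintegral_mono fun ω => ENNReal.ofReal_le_ofReal (ha (Z n ω))
  have hup : ∫⁻ ω, ENNReal.ofReal (1 / (φ (Z n ω) : ℝ)) ∂P ≤ ENNReal.ofReal (1 / (φ b : ℝ)) := by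
    calc _ ≤ ∫⁻ _, ENNReal.ofReal (1 / (φ b : ℝ)) ∂P :=
          lintegral_mono fun ω => ENNReal.ofReal_le_ofReal (hb (Z n ω))
      _ = ENNReal.ofReal (1 / (φ b : ℝ)) := by simp
  refine ⟨?_⟩
  rw [tiltedMeasure, Measure.smul_apply, withDensity_apply _ MeasurableSet.univ,
    Measure.restrict_univ, smul_eq_mul]
  exact ENNReal.inv_mul_cancel ((ENNReal.ofReal_pos.2 (hpos a)).trans_le hlow).ne'
    (hup.trans_lt ENNReal.ofReal_lt_top).ne

/-- The centered additive functional `S̃_n = ∑_{j=0}^n g̃(Z_j)`, where `g̃ = g - E_π g`. -/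
def centeredSum {L : Type*} [Fintype L] {E : Type*} [AddCommGroup E] [Module ℝ E] {Ω : Type*}
    (π : L → ℝ) (g : L → E) (Z : ℕ → Ω → L) (n : ℕ) (ω : Ω) : E :=
  ∑ j ∈ Finset.range (n + 1), centered π g (Z j ω)

end Chain

end FiniteChain

/-! The method is that of characteristic functions. With u = g̃, f = 1/φ and s = t/√(n+1), the
characteristic function under the tilted measure is E[exp(is S̃_n) f(Z_n)] / E[f(Z_n)]
(`integral_tiltedMeasure`). The numerator is μ (DQ)^n D f with D = diag(exp(isu))
(`IsMarkovChain.integral_exp_mul`), and the denominator is its value at t = 0.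

Split f into its mean E_π f and a centered part. The centered part dies out, since Q mixes and DQ is
a sup-norm contraction close to Q (`tendsto_twisted_pow_mulVec_zero`). On constants, 1 + ish + s²b
is an eigenvector of DQ up to o(s²), with eigenvalue 1 - s²σ²/2 (`isLittleO_approxEigenvector`);
over n steps the error stays o(1) and the eigenvalue powers tend to exp(-σ²t²/2). The factor E_π f
cancels in the ratio, so the tilt leaves no trace, and Lévy's continuity theorem gives the central
limit theorem. The weak law follows from it, applied to the real and imaginary parts of g. -/

namespace FiniteChain

/-! ### Mixing: positive powers, Doeblin contraction, and its stability under small twists. -/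

section Mixing

variable {L : Type*} [Fintype L] [DecidableEq L]

theorem pow_add_apply_pos {Q : Matrix L L ℝ} (hQ : Q ∈ Matrix.rowStochastic ℝ L) {m n : ℕ}
    {x y z : L} (hm : 0 < (Q ^ m) x y) (hn : 0 < (Q ^ n) y z) : 0 < (Q ^ (m + n)) x z := by
  rw [pow_add, Matrix.mul_apply]
  exact Finset.sum_pos'
    (fun i _ => mul_nonneg ((pow_mem hQ m).1 x i) ((pow_mem hQ n).1 i z))
    ⟨y, Finset.mem_univ y, mul_pos hm hn⟩

/-- Return times are closed under addition, and a subsemigroup of ℕ with gcd 1 contains every large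
integer. -/
theorem eventually_pow_apply_self_pos {Q : Matrix L L ℝ} (hQ : Q ∈ Matrix.rowStochastic ℝ L)
    (haper : IsAperiodic Q) (x : L) : ∀ᶠ n in atTop, 0 < (Q ^ n) x x := by
  obtain ⟨N, hN⟩ := Nat.exists_mem_closure_of_ge {k | 0 < k ∧ 0 < (Q ^ k) x x}
  filter_upwards [eventually_ge_atTop N] with n hn
  have hgcd : Nat.setGcd {k | 0 < k ∧ 0 < (Q ^ k) x x} = 1 :=
    haper x _ fun k hk hk' => Nat.setGcd_dvd_of_mem ⟨hk, hk'⟩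
  refine AddSubmonoid.closure_induction (motive := fun m _ => 0 < (Q ^ m) x x)
    (fun m hm => hm.2) (by simp) (fun m k _ _ hm hk => pow_add_apply_pos hQ hm hk)
    (hN n hn (hgcd ▸ one_dvd n))

/-- Some power of the transition matrix of an irreducible aperiodic chain is positive. -/
theorem exists_pow_pos {Q : Matrix L L ℝ} (hQ : Q ∈ Matrix.rowStochastic ℝ L)
    (hirr : Q.IsIrreducible) (haper : IsAperiodic Q) : ∃ N, ∀ x y, 0 < (Q ^ N) x y := by
  have h : ∀ᶠ n in atTop, ∀ x y, 0 < (Q ^ n) x y := by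
    refine eventually_all.2 fun x => eventually_all.2 fun y => ?_
    obtain ⟨k, -, hk⟩ := (Matrix.isIrreducible_iff_exists_pow_pos hQ.1).1 hirr x y
    filter_upwards [(tendsto_sub_atTop_nat k).eventually (eventually_pow_apply_self_pos hQ haper x),
      eventually_ge_atTop k] with n hn hkn
    rw [← Nat.sub_add_cancel hkn]
    exact pow_add_apply_pos hQ hn hk
  exact h.exists

/-- The matrix `D Q`, where `D` is the diagonal matrix with entries `d`. -/
noncomputable def twisted (Q : Matrix L L ℝ) (d : L → ℂ) : Matrix L L ℂ :=
  Matrix.diagonal d * Q.map Complex.ofReal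

theorem twisted_mulVec_apply (Q : Matrix L L ℝ) (d v : L → ℂ) (x : L) :
    (twisted Q d *ᵥ v) x = d x * ∑ y, (Q x y : ℂ) * v y := by
  rw [twisted, ← Matrix.mulVec_mulVec, Matrix.mulVec_diagonal]
  rfl

theorem twisted_one (Q : Matrix L L ℝ) : twisted Q 1 = Q.map Complex.ofReal := by
  simp [twisted]

theorem twisted_one_pow (Q : Matrix L L ℝ) (k : ℕ) :
    twisted Q 1 ^ k = (Q ^ k).map Complex.ofReal := by
  rw [twisted_one]
  exact (map_pow (Complex.ofRealHom.mapMatrix (m := L)) Q k).symm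

theorem norm_twisted_mulVec_le {Q : Matrix L L ℝ} (hQ : Q ∈ Matrix.rowStochastic ℝ L)
    {d : L → ℂ} (hd : ∀ x, ‖d x‖ ≤ 1) (v : L → ℂ) : ‖twisted Q d *ᵥ v‖ ≤ ‖v‖ := by
  refine (pi_norm_le_iff_of_nonneg (norm_nonneg v)).2 fun x => ?_
  rw [twisted_mulVec_apply, norm_mul]
  have h : ‖∑ y, (Q x y : ℂ) * v y‖ ≤ ‖v‖ := by
    calc _ ≤ ∑ y, Q x y * ‖v‖ := norm_sum_le_of_le _ fun y _ => by
          rw [norm_mul, Complex.norm_real, Real.norm_of_nonneg (hQ.1 x y)]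
          exact mul_le_mul_of_nonneg_left (norm_le_pi_norm v y) (hQ.1 x y)
      _ = ‖v‖ := by rw [← Finset.sum_mul, Matrix.sum_row_of_mem_rowStochastic hQ, one_mul]
  exact (mul_le_of_le_one_left (norm_nonneg _) (hd x)).trans h

theorem norm_twisted_pow_mulVec_le {Q : Matrix L L ℝ} (hQ : Q ∈ Matrix.rowStochastic ℝ L)
    {d : L → ℂ} (hd : ∀ x, ‖d x‖ ≤ 1) (n : ℕ) (v : L → ℂ) : ‖twisted Q d ^ n *ᵥ v‖ ≤ ‖v‖ := by
  induction n generalizing v with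
  | zero => simp
  | succ n ih =>
    rw [pow_succ, ← Matrix.mulVec_mulVec]
    exact (ih _).trans (norm_twisted_mulVec_le hQ hd v)

theorem expect_twisted_one_mulVec {Q : Matrix L L ℝ} {π : L → ℝ} (hπ : π ᵥ* Q = π) (f : L → ℂ) :
    expect π (twisted Q 1 *ᵥ f) = expect π f := by
  change ∑ z, π z • (twisted Q 1 *ᵥ f) z = ∑ z, π z • f z
  simp only [twisted_mulVec_apply, Complex.real_smul, Pi.one_apply, one_mul, Finset.mul_sum]
  rw [Finset.sum_comm]
  refine Finset.sum_congr rfl fun y _ => ?_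
  rw [← congrFun hπ y]
  simp [Matrix.vecMul, dotProduct, Finset.sum_mul, mul_assoc]

/-- Doeblin's contraction estimate for a matrix with all entries at least `c`. -/
theorem norm_twisted_one_mulVec_le_of_le {Q : Matrix L L ℝ} (hQ : Q ∈ Matrix.rowStochastic ℝ L)
    {π : L → ℝ} (hπ : π ∈ stdSimplex ℝ L) {c : ℝ} (hc0 : 0 ≤ c) (hc : ∀ x y, c ≤ Q x y)
    {f : L → ℂ} (hf : expect π f = 0) : ‖twisted Q 1 *ᵥ f‖ ≤ |1 - c| * ‖f‖ := by
  refine (pi_norm_le_iff_of_nonneg (by positivity)).2 fun x => ?_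
  have hf' : ∑ y, (π y : ℂ) * f y = 0 := hf
  have hpos : ∀ y, 0 ≤ Q x y - c * π y := fun y => by
    have h1 : π y ≤ 1 := hπ.2 ▸ Finset.single_le_sum (fun z _ => hπ.1 z) (Finset.mem_univ y)
    nlinarith [hc x y]
  -- Since E_π f = 0, subtracting cπ from the row is free; what is left is nonnegative with total
  -- mass 1 - c.
  have h : (twisted Q 1 *ᵥ f) x = ∑ y, ((Q x y - c * π y : ℝ) : ℂ) * f y := by
    rw [twisted_mulVec_apply]
    simp only [Complex.ofReal_sub, Complex.ofReal_mul, sub_mul, Finset.sum_sub_distrib, mul_assoc]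
    rw [← Finset.mul_sum, hf']
    simp
  rw [h]
  calc _ ≤ ∑ y, (Q x y - c * π y) * ‖f‖ := norm_sum_le_of_le _ fun y _ => by
        rw [norm_mul, Complex.norm_real, Real.norm_of_nonneg (hpos y)]
        exact mul_le_mul_of_nonneg_left (norm_le_pi_norm f y) (hpos y)
    _ = (1 - c) * ‖f‖ := by
        rw [← Finset.sum_mul, Finset.sum_sub_distrib, Matrix.sum_row_of_mem_rowStochastic hQ,
          ← Finset.mul_sum, hπ.2, mul_one]
    _ ≤ _ := mul_le_mul_of_nonneg_right (le_abs_self _) (norm_nonneg f)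

/-- An irreducible aperiodic chain forgets centered functions. -/
theorem exists_norm_twisted_one_pow_mulVec_lt {Q : Matrix L L ℝ}
    (hQ : Q ∈ Matrix.rowStochastic ℝ L) (hirr : Q.IsIrreducible) (haper : IsAperiodic Q)
    {π : L → ℝ} (hπ : IsStationary Q π) {f : L → ℂ} (hf : expect π f = 0) {ε : ℝ} (hε : 0 < ε) :
    ∃ k, ‖twisted Q 1 ^ k *ᵥ f‖ < ε := by
  obtain ⟨N, hN⟩ := exists_pow_pos hQ hirr haper
  obtain ⟨c, hc0, hc1, hc⟩ : ∃ c : ℝ, 0 < c ∧ c ≤ 1 ∧ ∀ x y, c ≤ (Q ^ N) x y := by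
    rcases isEmpty_or_nonempty L with hL | hL
    · exact ⟨1, one_pos, le_rfl, fun x => hL.elim x⟩
    obtain ⟨p, hp⟩ := Finite.exists_min fun p : L × L => (Q ^ N) p.1 p.2
    refine ⟨(Q ^ N) p.1 p.2, hN _ _, ?_, fun x y => hp (x, y)⟩
    rw [← Matrix.sum_row_of_mem_rowStochastic (pow_mem hQ N) p.1]
    exact Finset.single_le_sum (fun z _ => (pow_mem hQ N).1 p.1 z) (Finset.mem_univ p.2)
  have key : ∀ m : ℕ, expect π (twisted (Q ^ N) 1 ^ m *ᵥ f) = 0 ∧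
      ‖twisted (Q ^ N) 1 ^ m *ᵥ f‖ ≤ |1 - c| ^ m * ‖f‖ := by
    intro m
    induction m with
    | zero => simp [hf]
    | succ m ih =>
      rw [pow_succ', ← Matrix.mulVec_mulVec]
      refine ⟨by rw [expect_twisted_one_mulVec (vecMul_pow_eq hπ.vecMul_eq N), ih.1], ?_⟩
      refine (norm_twisted_one_mulVec_le_of_le (pow_mem hQ N) hπ.mem_stdSimplex hc0.le hc
        ih.1).trans ?_
      rw [pow_succ', mul_assoc]
      exact mul_le_mul_of_nonneg_left ih.2 (abs_nonneg _)
  have hlim : Tendsto (fun m : ℕ => |1 - c| ^ m * ‖f‖) atTop (𝓝 0) := by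
    have h1 : |1 - c| < 1 := by rw [abs_of_nonneg] <;> linarith
    simpa using (tendsto_pow_atTop_nhds_zero_of_lt_one (abs_nonneg _) h1).mul_const ‖f‖
  obtain ⟨m, hm⟩ := (hlim.eventually_lt_const hε).exists
  refine ⟨N * m, ?_⟩
  rw [pow_mul, twisted_one_pow, ← twisted_one]
  exact (key m).2.trans_lt hm

/-- Powers of slowly varying twisted matrices forget centered functions. -/
theorem tendsto_twisted_pow_mulVec_zero {Q : Matrix L L ℝ}
    (hQ : Q ∈ Matrix.rowStochastic ℝ L) (hirr : Q.IsIrreducible) (haper : IsAperiodic Q)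
    {π : L → ℝ} (hπ : IsStationary Q π) {f : L → ℂ} (hf : expect π f = 0)
    {d : ℕ → L → ℂ} (hd : ∀ n x, ‖d n x‖ ≤ 1) (hlim : Tendsto d atTop (𝓝 1)) :
    Tendsto (fun n => twisted Q (d n) ^ n *ᵥ f) atTop (𝓝 0) := by
  rw [tendsto_zero_iff_norm_tendsto_zero, Metric.tendsto_atTop']
  intro ε hε
  obtain ⟨k, hk⟩ := exists_norm_twisted_one_pow_mulVec_lt hQ hirr haper hπ hf hε
  have hc : Continuous fun e : L → ℂ => twisted Q e ^ k *ᵥ f := by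
    unfold twisted
    exact (((continuous_id.matrix_diagonal).matrix_mul continuous_const).pow k).matrix_mulVec
      continuous_const
  have h := ((hc.tendsto 1).comp hlim).norm.eventually_lt_const hk
  obtain ⟨m, hm⟩ := (h.and (eventually_ge_atTop k)).exists_forall_of_atTop
  refine ⟨m, fun n hn => ?_⟩
  obtain ⟨h1, h2⟩ := hm n hn.le
  rw [dist_zero_right, norm_norm]
  -- The last k factors already make the vector small, by continuity at d = 1 for fixed k; the other
  -- n - k factors do not increase the norm.
  refine lt_of_le_of_lt ?_ h1
  rw [← Nat.sub_add_cancel h2, pow_add, ← Matrix.mulVec_mulVec, Nat.sub_add_cancel h2]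
  exact norm_twisted_pow_mulVec_le hQ (hd n) _ _

end Mixing

/-! ### Powers of twisted matrices from approximate eigenvectors. -/

section Eigenvector

variable {L : Type*} [Fintype L] [DecidableEq L]

/-- Telescoping: the matrix and the scalar both have norm at most 1, so each step adds at most one
residual. -/
theorem norm_twisted_pow_mulVec_sub_le {Q : Matrix L L ℝ} (hQ : Q ∈ Matrix.rowStochastic ℝ L)
    {d : L → ℂ} (hd : ∀ x, ‖d x‖ ≤ 1) {l : ℂ} (hl : ‖l‖ ≤ 1) (v : L → ℂ) (n : ℕ) :
    ‖twisted Q d ^ n *ᵥ v - l ^ n • v‖ ≤ n * ‖twisted Q d *ᵥ v - l • v‖ := by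
  induction n with
  | zero => simp
  | succ n ih =>
    have h : twisted Q d ^ (n + 1) *ᵥ v - l ^ (n + 1) • v =
        twisted Q d ^ n *ᵥ (twisted Q d *ᵥ v - l • v) +
          l • (twisted Q d ^ n *ᵥ v - l ^ n • v) := by
      rw [Matrix.mulVec_sub, Matrix.mulVec_mulVec, ← pow_succ, Matrix.mulVec_smul, smul_sub,
        smul_smul, ← pow_succ']
      abel
    rw [h]
    refine (norm_add_le _ _).trans ?_
    have h1 := norm_twisted_pow_mulVec_le hQ hd n (twisted Q d *ᵥ v - l • v)
    have h2 : ‖l • (twisted Q d ^ n *ᵥ v - l ^ n • v)‖ ≤ ‖twisted Q d ^ n *ᵥ v - l ^ n • v‖ := by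
      rw [norm_smul]
      exact mul_le_of_le_one_left (norm_nonneg _) hl
    push_cast
    linarith

/-- Approximate eigenvectors close to `1` control the powers of twisted matrices. -/
theorem tendsto_twisted_pow_mulVec_one {Q : Matrix L L ℝ} (hQ : Q ∈ Matrix.rowStochastic ℝ L)
    {d : ℕ → L → ℂ} (hd : ∀ n x, ‖d n x‖ ≤ 1) {l : ℕ → ℂ} (hl : ∀ᶠ n in atTop, ‖l n‖ ≤ 1)
    {v : ℕ → L → ℂ} (hv : Tendsto v atTop (𝓝 1)) {c : ℂ}
    (hlc : Tendsto (fun n => l n ^ n) atTop (𝓝 c))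
    (hr : Tendsto (fun n : ℕ => n * ‖twisted Q (d n) *ᵥ v n - l n • v n‖) atTop (𝓝 0)) :
    Tendsto (fun n => twisted Q (d n) ^ n *ᵥ (1 : L → ℂ)) atTop (𝓝 (c • 1)) := by
  have h1 : Tendsto (fun n => twisted Q (d n) ^ n *ᵥ v n - l n ^ n • v n) atTop (𝓝 0) := by
    refine squeeze_zero_norm' ?_ hr
    filter_upwards [hl] with n hn
    exact norm_twisted_pow_mulVec_sub_le hQ (hd n) hn _ n
  have h2 : Tendsto (fun n => twisted Q (d n) ^ n *ᵥ (1 - v n)) atTop (𝓝 0) := by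
    have h3 : Tendsto (fun n => ‖1 - v n‖) atTop (𝓝 0) := by
      simpa using ((tendsto_const_nhds (x := (1 : L → ℂ))).sub hv).norm
    exact squeeze_zero_norm (fun n => norm_twisted_pow_mulVec_le hQ (hd n) n _) h3
  have h4 := (h2.add h1).add (hlc.smul hv)
  rw [add_zero, zero_add] at h4
  refine h4.congr fun n => ?_
  rw [Matrix.mulVec_sub]
  abel

end Eigenvector

/-! ### The variance and the second-order perturbation expansion. -/

section Variance

variable {L : Type*} [Fintype L] [DecidableEq L]

theorem sq_mulVec_le {Q : Matrix L L ℝ} (hQ : Q ∈ Matrix.rowStochastic ℝ L) (h : L → ℝ) (x : L) :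
    (Q *ᵥ h) x ^ 2 ≤ (Q *ᵥ (h ^ 2)) x := by
  have hc : ConvexOn ℝ Set.univ fun r : ℝ => r ^ 2 := (even_two).convexOn_pow
  simpa [Matrix.mulVec, dotProduct] using hc.map_sum_le (t := Finset.univ) (w := Q x) (p := h)
    (fun y _ => hQ.1 x y) (Matrix.sum_row_of_mem_rowStochastic hQ x) (fun y _ => Set.mem_univ _)

theorem expect_mulVec {Q : Matrix L L ℝ} {π : L → ℝ} (hπ : π ᵥ* Q = π) (h : L → ℝ) :
    expect π (Q *ᵥ h) = expect π h := by
  change π ⬝ᵥ (Q *ᵥ h) = π ⬝ᵥ h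
  rw [Matrix.dotProduct_mulVec, hπ]

theorem mulVec_groupInverse [Nonempty L] {Q : Matrix L L ℝ}
    (hQ : Q ∈ Matrix.rowStochastic ℝ L) (hirr : Q.IsIrreducible) (g : L → ℝ) (x : L) :
    (Q *ᵥ groupInverse hQ g) x = groupInverse hQ g x - centered (stationaryDist hQ) g x := by
  rw [← one_sub_mulVec_groupInverse hQ hirr g, Matrix.sub_mulVec, Matrix.one_mulVec]
  simp

theorem centered_centered {E : Type*} [AddCommGroup E] [Module ℝ E] {π : L → ℝ}
    (hπ : π ∈ stdSimplex ℝ L) (g : L → E) : centered π (centered π g) = centered π g := by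
  funext x
  rw [centered, expect_centered hπ, sub_zero]

/-- With h = Q^# g̃, σ² is the stationary mean of the one-step conditional variance Q(h²) - (Qh)²,
which is nonnegative by Jensen. -/
theorem asymptoticVariance_nonneg [Nonempty L] {Q : Matrix L L ℝ}
    (hQ : Q ∈ Matrix.rowStochastic ℝ L) (hirr : Q.IsIrreducible) (g : L → ℝ) :
    0 ≤ asymptoticVariance hQ g := by
  have hπ := isStationary_stationaryDist hQ
  set π := stationaryDist hQ
  set u := centered π g with hu
  set h := groupInverse hQ u with hh
  have hQh : ∀ x, (Q *ᵥ h) x = h x - u x := fun x => by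
    rw [hh, mulVec_groupInverse hQ hirr u x, hu, centered_centered hπ.mem_stdSimplex]
  have h1 : asymptoticVariance hQ g = expect π (Q *ᵥ (h ^ 2)) - expect π ((Q *ᵥ h) ^ 2) := by
    rw [expect_mulVec hπ.vecMul_eq, ← map_sub]
    change expect π (u * (2 • h - u)) = _
    congr 1
    funext x
    simp only [Pi.mul_apply, Pi.sub_apply, Pi.add_apply, Pi.pow_apply, hQh, two_nsmul]
    ring
  rw [h1, ← map_sub]
  exact Finset.sum_nonneg fun x _ =>
    mul_nonneg (hπ.mem_stdSimplex.1 x) (sub_nonneg.2 (sq_mulVec_le hQ h x))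

/-- The function `x ↦ exp (i s u(x))`. -/
noncomputable def phase (u : L → ℝ) (s : ℝ) (x : L) : ℂ :=
  Complex.exp (s * u x * Complex.I)

theorem norm_phase (u : L → ℝ) (s : ℝ) (x : L) : ‖phase u s x‖ = 1 := by
  rw [phase, ← Complex.ofReal_mul, Complex.norm_exp_ofReal_mul_I]

theorem continuous_phase (u : L → ℝ) : Continuous (phase u) := by
  unfold phase
  fun_prop

theorem phase_zero (u : L → ℝ) : phase u 0 = 1 := by
  funext x
  simp [phase]

open Asymptotics in
theorem isLittleO_phase_sub_taylor (r : ℝ) :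
    (fun s : ℝ => Complex.exp (s * r * Complex.I) -
      (1 + s * r * Complex.I - (s : ℂ) ^ 2 * r ^ 2 / 2)) =o[𝓝 0] fun s : ℝ => s ^ 2 := by
  have hlim : Tendsto (fun s : ℝ => (s * r * Complex.I : ℂ)) (𝓝 0) (𝓝 0) := by
    have : Continuous fun s : ℝ => (s * r * Complex.I : ℂ) := by fun_prop
    simpa using this.tendsto 0
  have h := (Complex.exp_sub_sum_range_isBigO_pow 3).comp_tendsto hlim
  have h1 : (fun s : ℝ => (s * r * Complex.I : ℂ) ^ 3) =O[𝓝 0] fun s : ℝ => s ^ 3 := by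
    refine IsBigO.of_bound (|r| ^ 3) (Eventually.of_forall fun s => le_of_eq ?_)
    simp [mul_pow, mul_comm]
  refine ((h.trans h1).trans_isLittleO (isLittleO_pow_pow (by norm_num))).congr_left fun s => ?_
  simp only [Function.comp_apply, Finset.sum_range_succ, Finset.sum_range_zero, Nat.factorial]
  push_cast
  linear_combination (-(s : ℂ) ^ 2 * r ^ 2 / 2) * Complex.I_sq

/-- The approximate eigenvector `1 + i s h + s² b` of the twisted matrix. -/
noncomputable def approxEigenvector (h b : L → ℝ) (s : ℝ) (x : L) : ℂ :=
  1 + s * h x * Complex.I + (s : ℂ) ^ 2 * b x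

open Asymptotics in
-- The hypotheses on h and b are exactly the equality of the coefficients of s and s² on both sides;
-- the order s⁰ is row-stochasticity.
theorem isLittleO_approxEigenvector {Q : Matrix L L ℝ} (hQ : Q ∈ Matrix.rowStochastic ℝ L)
    {u h b : L → ℝ} {κ : ℝ} (hh : ∀ x, (Q *ᵥ h) x = h x - u x)
    (hb : ∀ x, (Q *ᵥ b) x = b x - κ + (u x * (h x - u x) + u x ^ 2 / 2)) :
    (fun s : ℝ => ‖twisted Q (phase u s) *ᵥ approxEigenvector h b s -
      (1 - (s : ℂ) ^ 2 * κ) • approxEigenvector h b s‖) =o[𝓝 0] fun s : ℝ => s ^ 2 := by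
  rw [isLittleO_norm_left, isLittleO_pi]
  intro x
  have hmul : ∀ s : ℝ, ∑ y, (Q x y : ℂ) * approxEigenvector h b s y =
      1 + s * (h x - u x) * Complex.I +
        (s : ℂ) ^ 2 * (b x - κ + (u x * (h x - u x) + u x ^ 2 / 2)) := fun s => by
    have e1 : ∑ y, (Q x y : ℂ) = 1 := by
      exact_mod_cast Matrix.sum_row_of_mem_rowStochastic hQ x
    have e2 : ∑ y, (Q x y : ℂ) * h y = h x - u x := by exact_mod_cast hh x
    have e3 : ∑ y, (Q x y : ℂ) * b y = b x - κ + (u x * (h x - u x) + u x ^ 2 / 2) := by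
      exact_mod_cast hb x
    rw [← e3, ← e2, ← e1]
    simp only [approxEigenvector, Finset.mul_sum, Finset.sum_mul, ← Finset.sum_add_distrib]
    exact Finset.sum_congr rfl fun y _ => by ring
  set A : ℂ := h x - u x with hA
  set B : ℂ := b x - κ + (u x * (h x - u x) + u x ^ 2 / 2) with hB
  have hO : ∀ F : ℝ → ℂ, Continuous F → F =O[𝓝 0] fun _ => (1 : ℝ) := fun F hF =>
    (hF.tendsto 0).isBigO_one ℝ
  have t1 := (isLittleO_phase_sub_taylor (u x)).mul_isBigO
    (hO (fun s => 1 + s * A * Complex.I + (s : ℂ) ^ 2 * B) (by fun_prop))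
  have t2 : (fun s : ℝ => (s : ℂ) ^ 3) =o[𝓝 0] fun s : ℝ => s ^ 2 := by
    refine IsBigO.trans_isLittleO (g := fun s : ℝ => s ^ 3) ?_ (isLittleO_pow_pow (by norm_num))
    exact IsBigO.of_bound 1 (Eventually.of_forall fun s => by simp)
  -- These are the s³ and s⁴ terms that survive when the Taylor polynomial of the phase replaces the
  -- phase.
  have t3 := t2.mul_isBigO (hO (fun s => Complex.I * (u x * B - u x ^ 2 * A / 2 + κ * h x) +
    s * (κ * b x - u x ^ 2 * B / 2)) (by fun_prop))
  simp only [mul_one] at t1 t3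
  refine (t1.add t3).congr_left fun s => ?_
  rw [Pi.sub_apply, Pi.smul_apply, twisted_mulVec_apply, hmul, smul_eq_mul]
  simp only [approxEigenvector, phase]
  rw [hB, hA]
  linear_combination (-(s : ℂ) ^ 2 * u x * (h x - u x)) * Complex.I_sq

/-- Both conditions are Poisson equations, solved by the group inverse. The second is solvable only
if its source has π-mean zero, which forces the constant σ²/2. -/
theorem exists_approxEigenvector [Nonempty L] {Q : Matrix L L ℝ}
    (hQ : Q ∈ Matrix.rowStochastic ℝ L) (hirr : Q.IsIrreducible) (g : L → ℝ) :
    ∃ h b : L → ℝ, (∀ x, (Q *ᵥ h) x = h x - centered (stationaryDist hQ) g x) ∧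
      ∀ x, (Q *ᵥ b) x = b x - asymptoticVariance hQ g / 2 +
        (centered (stationaryDist hQ) g x * (h x - centered (stationaryDist hQ) g x) +
          centered (stationaryDist hQ) g x ^ 2 / 2) := by
  have hπ := isStationary_stationaryDist hQ
  set π := stationaryDist hQ
  set u := centered π g with hu
  set h := groupInverse hQ u with hh
  set q : L → ℝ := fun x => u x * (h x - u x) + u x ^ 2 / 2 with hq
  have hσ : expect π q = asymptoticVariance hQ g / 2 := by
    change _ = expect π (u * (2 • h - u)) / 2
    rw [div_eq_inv_mul, ← smul_eq_mul, ← map_smul]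
    congr 1
    funext x
    simp only [hq, Pi.mul_apply, Pi.sub_apply, Pi.add_apply, Pi.smul_apply, two_nsmul, smul_eq_mul]
    ring
  refine ⟨h, -groupInverse hQ q, fun x => ?_, fun x => ?_⟩
  · rw [hh, mulVec_groupInverse hQ hirr u x, hu, centered_centered hπ.mem_stdSimplex]
  · rw [Matrix.mulVec_neg, Pi.neg_apply, mulVec_groupInverse hQ hirr q x, Pi.neg_apply, ← hσ]
    simp only [centered, hq]
    ring

end Variance

/-! ### Limit of the n-th power at scale s = t/√(n+1). -/

section Asymptotics

variable {L : Type*} [Fintype L] [DecidableEq L] [Nonempty L]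

theorem tendsto_div_sqrt_succ (t : ℝ) : Tendsto (fun n : ℕ => t / √(n + 1)) atTop (𝓝 0) :=
  tendsto_const_nhds.div_atTop
    (Real.tendsto_sqrt_atTop.comp (tendsto_natCast_atTop_atTop.atTop_add tendsto_const_nhds))

theorem tendsto_natCast_mul_sq_div_sqrt_succ (t : ℝ) :
    Tendsto (fun n : ℕ => (n : ℝ) * (t / √(n + 1)) ^ 2) atTop (𝓝 (t ^ 2)) := by
  have h := (tendsto_natCast_div_add_atTop (1 : ℝ)).mul_const (t ^ 2)
  rw [one_mul] at h
  refine h.congr fun n => ?_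
  rw [div_pow, Real.sq_sqrt (by positivity)]
  ring

/-- Convergence of the operators that compute the characteristic function. -/
theorem tendsto_twisted_phase_pow_mulVec {Q : Matrix L L ℝ}
    (hQ : Q ∈ Matrix.rowStochastic ℝ L) (hirr : Q.IsIrreducible) (haper : IsAperiodic Q)
    (g : L → ℝ) (f : L → ℂ) (t : ℝ) :
    Tendsto (fun n : ℕ => twisted Q (phase (centered (stationaryDist hQ) g) (t / √(n + 1))) ^ n *ᵥ
        (phase (centered (stationaryDist hQ) g) (t / √(n + 1)) * f)) atTop
      (𝓝 ((Complex.exp (-(asymptoticVariance hQ g * t ^ 2 / 2)) *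
        expect (stationaryDist hQ) f) • 1)) := by
  have hπ := isStationary_stationaryDist hQ
  obtain ⟨h, b, hh, hb⟩ := exists_approxEigenvector hQ hirr g
  have hσ := asymptoticVariance_nonneg hQ hirr g
  set π := stationaryDist hQ
  set u := centered π g
  set κ := asymptoticVariance hQ g / 2 with hκ
  have hs := tendsto_div_sqrt_succ t
  set s : ℕ → ℝ := fun n => t / √(n + 1) with hsdef
  have hns := tendsto_natCast_mul_sq_div_sqrt_succ t
  have hd : ∀ n x, ‖phase u (s n) x‖ ≤ 1 := fun n x => (norm_phase u _ x).le
  have hlim : Tendsto (fun n => phase u (s n)) atTop (𝓝 1) := by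
    have := ((continuous_phase u).tendsto 0).comp hs
    rwa [phase_zero] at this
  have hone : Tendsto (fun n => twisted Q (phase u (s n)) ^ n *ᵥ (1 : L → ℂ)) atTop
      (𝓝 (Complex.exp (-(asymptoticVariance hQ g * t ^ 2 / 2)) • 1)) := by
    refine tendsto_twisted_pow_mulVec_one hQ hd (l := fun n => 1 - (s n : ℂ) ^ 2 * κ)
      (v := fun n => approxEigenvector h b (s n)) ?_ ?_ ?_ ?_
    · have h1 : Tendsto (fun n => s n ^ 2 * κ) atTop (𝓝 0) := by
        simpa using (hs.pow 2).mul_const κ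
      -- Nonnegativity of σ² is what keeps the approximate eigenvalue inside the unit disc.
      filter_upwards [h1.eventually_le_const one_pos] with n hn
      have h2 : 0 ≤ s n ^ 2 * κ := mul_nonneg (sq_nonneg _) (div_nonneg hσ zero_le_two)
      have h3 : (1 - (s n : ℂ) ^ 2 * κ) = ((1 - s n ^ 2 * κ : ℝ) : ℂ) := by push_cast; ring
      rw [h3, Complex.norm_real, Real.norm_eq_abs, abs_le]
      constructor <;> linarith
    · have hc : Continuous (approxEigenvector h b) := by
        unfold approxEigenvector
        fun_prop
      have h0 : approxEigenvector h b 0 = 1 := by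
        funext x
        simp [approxEigenvector]
      have := (hc.tendsto 0).comp hs
      rwa [h0] at this
    · simp only [sub_eq_add_neg]
      refine Complex.tendsto_one_add_pow_exp_of_tendsto ?_
      have h1 := ((Complex.continuous_ofReal.tendsto _).comp (hns.mul_const κ)).neg
      have h2 : -((t ^ 2 * κ : ℝ) : ℂ) = -(asymptoticVariance hQ g * t ^ 2 / 2) := by
        rw [hκ]
        push_cast
        ring
      rw [h2] at h1
      refine h1.congr fun n => ?_
      simp only [Function.comp_apply, hsdef]
      push_cast
      ring
    -- The n accumulated residuals are n · o(s²), and n s² is bounded.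
    · have h1 := ((isLittleO_approxEigenvector hQ hh hb).comp_tendsto hs)
      have h2 := (Asymptotics.isBigO_refl (fun n : ℕ => (n : ℝ)) atTop).mul_isLittleO h1
      exact (Asymptotics.isLittleO_one_iff ℝ).1 (h2.trans_isBigO (hns.isBigO_one ℝ))
  have hzero : Tendsto (fun n => twisted Q (phase u (s n)) ^ n *ᵥ centered π f) atTop (𝓝 0) :=
    tendsto_twisted_pow_mulVec_zero hQ hirr haper hπ (expect_centered hπ.mem_stdSimplex f) hd hlim
  have hdiff : Tendsto (fun n => twisted Q (phase u (s n)) ^ n *ᵥ (phase u (s n) * f - f))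
      atTop (𝓝 0) := by
    refine squeeze_zero_norm (fun n => norm_twisted_pow_mulVec_le hQ (hd n) n _) ?_
    simpa using ((hlim.mul_const f).sub_const f).norm
  -- Decomposition: phase · f = (phase · f - f) + (f - E_π f) + E_π f.
  have hall := (hdiff.add hzero).add (hone.const_smul (expect π f))
  rw [add_zero, zero_add, smul_smul, mul_comm] at hall
  refine hall.congr fun n => ?_
  rw [← Matrix.mulVec_smul, ← Matrix.mulVec_add, ← Matrix.mulVec_add]
  congr 1
  funext x
  simp [centered, hsdef]

end Asymptotics

/-! ### From path expectations to matrix powers, and the tilt as a ratio. -/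

section Path

variable {L : Type*} [Fintype L] [DecidableEq L]

/-- Transfer matrix formula for multiplicative functionals of paths. -/
theorem sum_path_eq (Q : Matrix L L ℝ) (d f : L → ℂ) (n : ℕ) (μ : L → ℝ) :
    ∑ z : Fin (n + 1) → L, ((μ (z 0) * ∏ j : Fin n, Q (z j.castSucc) (z j.succ) : ℝ) : ℂ) *
        ((∏ j, d (z j)) * f (z (Fin.last n))) =
      ∑ x, (μ x : ℂ) * (twisted Q d ^ n *ᵥ (d * f)) x := by
  induction n generalizing μ with
  | zero =>
    rw [← (Equiv.funUnique (Fin 1) L).sum_comp]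
    simp [Equiv.funUnique]
  | succ n ih =>
    -- Peel off the initial state x; the rest of the path has initial weights `Q x`, which is why
    -- the induction is over all μ.
    rw [← (Fin.consEquiv fun _ : Fin (n + 2) => L).sum_comp, Fintype.sum_prod_type]
    refine Finset.sum_congr rfl fun x _ => ?_
    rw [pow_succ', ← Matrix.mulVec_mulVec, twisted_mulVec_apply, ← ih (Q x), Finset.mul_sum,
      Finset.mul_sum]
    refine Finset.sum_congr rfl fun z _ => ?_
    simp only [Fin.consEquiv, Equiv.coe_fn_mk]
    rw [Fin.prod_univ_succ (n := n + 1), Fin.prod_univ_succ (n := n)]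
    simp only [Fin.castSucc_zero, Fin.castSucc_succ, Fin.cons_zero, Fin.cons_succ, ← Fin.succ_last]
    push_cast
    ring

variable [MeasurableSpace L] [MeasurableSingletonClass L] {Ω : Type*} [MeasurableSpace Ω]
  {P : Measure Ω} [IsProbabilityMeasure P] {Z : ℕ → Ω → L} {μ : L → ℝ} {Q : Matrix L L ℝ}

theorem IsMarkovChain.integral_path (hZ : IsMarkovChain P Z μ Q)
    (hQ : Q ∈ Matrix.rowStochastic ℝ L) (hμ : μ ∈ stdSimplex ℝ L) (n : ℕ)
    (G : (Fin (n + 1) → L) → ℂ) :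
    ∫ ω, G (fun j => Z j ω) ∂P =
      ∑ z, ((μ (z 0) * ∏ j : Fin n, Q (z j.castSucc) (z j.succ) : ℝ) : ℂ) * G z := by
  have hX : Measurable fun ω (j : Fin (n + 1)) => Z j ω :=
    measurable_pi_lambda _ fun j => hZ.measurable j
  have : IsProbabilityMeasure (P.map fun ω (j : Fin (n + 1)) => Z j ω) :=
    Measure.isProbabilityMeasure_map hX.aemeasurable
  rw [← integral_map (φ := fun ω (j : Fin (n + 1)) => Z j ω) (f := G) hX.aemeasurable
    (measurable_of_finite G).aestronglyMeasurable, integral_fintype Integrable.of_finite]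
  refine Finset.sum_congr rfl fun z _ => ?_
  -- The law is stated for infinite sequences; `Fin.ofNat` extends z periodically, and only the
  -- indices up to n matter.
  have hset : (fun ω (j : Fin (n + 1)) => Z j ω) ⁻¹' {z} =
      {ω | ∀ j ≤ n, Z j ω = z (Fin.ofNat (n + 1) j)} := by
    ext ω
    simp only [Set.mem_preimage, Set.mem_singleton_iff, funext_iff, Set.mem_ofPred_eq]
    refine ⟨fun h j hj => ?_, fun h j => ?_⟩
    · have := h (Fin.ofNat (n + 1) j)
      rwa [Fin.val_ofNat, Nat.mod_eq_of_lt (Nat.lt_succ_of_le hj)] at this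
    · have := h j (Nat.le_of_lt_succ j.2)
      rwa [Fin.ofNat_val_eq_self] at this
  have hprod : ∏ j ∈ Finset.range n, Q (z (Fin.ofNat (n + 1) j)) (z (Fin.ofNat (n + 1) (j + 1))) =
      ∏ j : Fin n, Q (z j.castSucc) (z j.succ) := by
    rw [Finset.prod_range]
    refine Finset.prod_congr rfl fun j _ => ?_
    have h1 : Fin.ofNat (n + 1) j = j.castSucc := Fin.ext (Nat.mod_eq_of_lt (by omega))
    have h2 : Fin.ofNat (n + 1) (j + 1) = j.succ := Fin.ext (Nat.mod_eq_of_lt (by omega))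
    rw [h1, h2]
  rw [Measure.real, Measure.map_apply hX (measurableSet_singleton z), hset, hZ.law, hprod,
    ENNReal.toReal_ofReal (mul_nonneg (hμ.1 _) (Finset.prod_nonneg fun j _ => hQ.1 _ _)),
    Complex.real_smul]
  rfl

/-- There are n + 1 visited states but only n transitions, so the phase of the last state is
attached to f. -/
theorem IsMarkovChain.integral_exp_mul (hZ : IsMarkovChain P Z μ Q)
    (hQ : Q ∈ Matrix.rowStochastic ℝ L) (hμ : μ ∈ stdSimplex ℝ L) (u : L → ℝ) (s : ℝ)
    (f : L → ℂ) (n : ℕ) :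
    ∫ ω, Complex.exp (s * (∑ j ∈ Finset.range (n + 1), u (Z j ω) : ℝ) * Complex.I) *
        f (Z n ω) ∂P =
      ∑ x, (μ x : ℂ) * (twisted Q (phase u s) ^ n *ᵥ (phase u s * f)) x := by
  rw [← sum_path_eq, ← hZ.integral_path hQ hμ n
    fun z => (∏ j, phase u s (z j)) * f (z (Fin.last n))]
  refine integral_congr_ae (Eventually.of_forall fun ω => ?_)
  simp only [phase, Fin.val_last]
  rw [← Complex.exp_sum, Finset.sum_range]
  simp only [Complex.ofReal_sum, Finset.mul_sum, Finset.sum_mul]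

theorem integral_tiltedMeasure (hZ : ∀ n, Measurable (Z n)) (φ : L → Set.Ioi (0 : ℝ)) (n : ℕ)
    (F : Ω → ℂ) :
    ∫ ω, F ω ∂tiltedMeasure P Z φ n =
      (∫ ω, F ω * (1 / (φ (Z n ω) : ℝ) : ℝ) ∂P) / ∫ ω, ((1 / (φ (Z n ω) : ℝ) : ℝ) : ℂ) ∂P := by
  have hmeas : Measurable fun ω => 1 / (φ (Z n ω) : ℝ) :=
    (measurable_of_finite fun z => 1 / (φ z : ℝ)).comp (hZ n)
  have hpos : ∀ ω, 0 ≤ 1 / (φ (Z n ω) : ℝ) := fun ω => (one_div_pos.2 (φ (Z n ω)).2).le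
  rw [tiltedMeasure, integral_smul_measure, integral_withDensity_eq_integral_toReal_smul
    hmeas.ennreal_ofReal (Eventually.of_forall fun _ => ENNReal.ofReal_lt_top), integral_complex_ofReal,
    integral_eq_lintegral_of_nonneg_ae (Eventually.of_forall hpos) hmeas.aestronglyMeasurable,
    ENNReal.toReal_inv, div_eq_inv_mul, Complex.real_smul, Complex.ofReal_inv]
  congr 1
  refine integral_congr_ae (Eventually.of_forall fun ω => ?_)
  simp only [ENNReal.toReal_ofReal (hpos ω), Complex.real_smul, mul_comm]

end Path

/-! ### The limit theorems under the tilted measures. -/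

section Limit

variable {L : Type*} [Fintype L] [DecidableEq L] [Nonempty L]
  [MeasurableSpace L] [MeasurableSingletonClass L] {Ω : Type*} [MeasurableSpace Ω]
  {P : Measure Ω} [IsProbabilityMeasure P] {Z : ℕ → Ω → L} {μ : L → ℝ} {Q : Matrix L L ℝ}

theorem measurable_centeredSum {E : Type*} [AddCommGroup E] [Module ℝ E] [MeasurableSpace E]
    [MeasurableAdd₂ E] (hZ : ∀ n, Measurable (Z n)) (π : L → ℝ) (g : L → E) (n : ℕ) :
    Measurable (centeredSum π g Z n) := by
  unfold centeredSum
  exact Finset.measurable_fun_sum _ fun j _ => (measurable_of_finite (centered π g)).comp (hZ j)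

theorem IsMarkovChain.tendsto_integral_exp (hZ : IsMarkovChain P Z μ Q)
    (hQ : Q ∈ Matrix.rowStochastic ℝ L) (hirr : Q.IsIrreducible) (haper : IsAperiodic Q)
    (hμ : μ ∈ stdSimplex ℝ L) (g : L → ℝ) (f : L → ℂ) (t : ℝ) :
    Tendsto (fun n : ℕ => ∫ ω, Complex.exp ((t / √(n + 1) : ℝ) *
        centeredSum (stationaryDist hQ) g Z n ω * Complex.I) * f (Z n ω) ∂P) atTop
      (𝓝 (Complex.exp (-(asymptoticVariance hQ g * t ^ 2 / 2)) *
        expect (stationaryDist hQ) f)) := by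
  have h := tendsto_pi_nhds.1 (tendsto_twisted_phase_pow_mulVec hQ hirr haper g f t)
  have h1 := tendsto_finsetSum Finset.univ fun x _ => (h x).const_mul (μ x : ℂ)
  simp only [Pi.smul_apply, Pi.one_apply, smul_eq_mul, mul_one] at h1
  -- The limit vector is constant in the starting state, so μ enters only through its total mass 1.
  rw [← Finset.sum_mul, ← Complex.ofReal_sum, hμ.2, Complex.ofReal_one, one_mul] at h1
  exact h1.congr fun n => (hZ.integral_exp_mul hQ hμ _ _ f n).symm

/-- The central limit theorem under the tilted measures. -/
theorem IsMarkovChain.tendstoInDistribution (hZ : IsMarkovChain P Z μ Q)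
    (hQ : Q ∈ Matrix.rowStochastic ℝ L) (hirr : Q.IsIrreducible) (haper : IsAperiodic Q)
    (hμ : μ ∈ stdSimplex ℝ L) (φ : L → Set.Ioi (0 : ℝ)) (g : L → ℝ) :
    TendstoInDistribution
      (fun (n : ℕ) (ω : Ω) => centeredSum (stationaryDist hQ) g Z n ω / √(n + 1))
      atTop (id : ℝ → ℝ) (fun n => tiltedMeasure P Z φ n)
      (gaussianReal 0 (asymptoticVariance hQ g).toNNReal) := by
  have hπ := isStationary_stationaryDist hQ
  have hm := measurable_centeredSum hZ.measurable (stationaryDist hQ) g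
  refine ⟨fun n => ((hm n).div_const _).aemeasurable, aemeasurable_id,
    ProbabilityMeasure.tendsto_of_tendsto_charFun fun t => ?_⟩
  set f : L → ℂ := fun z => ((1 / (φ z : ℝ) : ℝ) : ℂ) with hf
  have hne : expect (stationaryDist hQ) f ≠ 0 := by
    have h1 : expect (stationaryDist hQ) f =
        ((∑ z, stationaryDist hQ z * (1 / (φ z : ℝ)) : ℝ) : ℂ) := by
      change ∑ z, stationaryDist hQ z • f z = _
      simp [hf]
    rw [h1, Complex.ofReal_ne_zero]
    have hpos : ∀ z, 0 < 1 / (φ z : ℝ) := fun z => one_div_pos.2 (φ z).2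
    intro h0
    have h2 := (Finset.sum_eq_zero_iff_of_nonneg fun z _ =>
      mul_nonneg (hπ.mem_stdSimplex.1 z) (hpos z).le).1 h0
    have h3 : ∑ z, stationaryDist hQ z = 0 := Finset.sum_eq_zero fun z hz =>
      (mul_eq_zero.1 (h2 z hz)).resolve_right (hpos z).ne'
    exact one_ne_zero (hπ.mem_stdSimplex.2.symm.trans h3)
  have hnum := hZ.tendsto_integral_exp hQ hirr haper hμ g f t
  -- At t = 0 the same limit gives the normalizing constant, E[f(Z_n)] → E_π f.
  have hden := hZ.tendsto_integral_exp hQ hirr haper hμ g f 0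
  simp only [zero_div, Complex.ofReal_zero, zero_mul, Complex.exp_zero, one_mul, ne_eq,
    OfNat.ofNat_ne_zero, not_false_eq_true, zero_pow, mul_zero, neg_zero] at hden
  have h := hnum.div hden hne
  rw [mul_div_cancel_right₀ _ hne] at h
  have hlim : charFun ((gaussianReal 0 (asymptoticVariance hQ g).toNNReal).map id) t =
      Complex.exp (-(asymptoticVariance hQ g * t ^ 2 / 2)) := by
    rw [Measure.map_id, charFun_gaussianReal,
      Real.coe_toNNReal _ (asymptoticVariance_nonneg hQ hirr g)]
    congr 1
    push_cast
    ring
  change Tendsto _ _ (𝓝 (charFun ((gaussianReal 0 (asymptoticVariance hQ g).toNNReal).map id) t))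
  rw [hlim]
  refine h.congr fun n => ?_
  change _ = charFun ((tiltedMeasure P Z φ n).map _) t
  rw [charFun_apply_real, integral_map ((hm n).div_const _).aemeasurable
    (by fun_prop), integral_tiltedMeasure hZ.measurable]
  simp only [Pi.div_apply, hf]
  congr 1
  refine integral_congr_ae (Eventually.of_forall fun ω => ?_)
  simp only
  congr 2
  push_cast
  ring

/-- Convergence in distribution of `X_n` implies that `X_n / √(n + 1)` tends to `0`
in probability. -/
theorem tendsto_measure_mul_sqrt_lt_of_tendstoInDistribution {Ω' : Type*}
    [MeasurableSpace Ω'] {R : ℕ → Measure Ω'} [∀ n, IsProbabilityMeasure (R n)]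
    {X : ℕ → Ω' → ℝ} {ν : Measure ℝ} [IsProbabilityMeasure ν]
    (h : TendstoInDistribution X atTop (id : ℝ → ℝ) R ν) {δ : ℝ} (hδ : 0 < δ) :
    Tendsto (fun n : ℕ => R n {ω | δ * √(n + 1) < |X n ω|}) atTop (𝓝 0) := by
  -- The limit law has small tails; the portmanteau theorem passes a fixed tail {|x| ≥ K} to X_n,
  -- and δ√(n+1) eventually exceeds K.
  have htail : Tendsto (fun K : ℕ => ν {x | (K : ℝ) ≤ |x|}) atTop (𝓝 0) := by
    have h1 := tendsto_measure_iInter_atTop (μ := ν) (s := fun K : ℕ => {x : ℝ | (K : ℝ) ≤ |x|})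
      (fun K => (measurableSet_le measurable_const measurable_id.abs).nullMeasurableSet)
      (fun a b hab x (hx : (b : ℝ) ≤ |x|) => (Nat.cast_le.2 hab).trans hx) ⟨0, measure_ne_top _ _⟩
    have h2 : ⋂ K : ℕ, {x : ℝ | (K : ℝ) ≤ |x|} = ∅ := by
      ext x
      simp only [Set.mem_iInter, Set.mem_ofPred_eq, Set.mem_empty_iff_false, iff_false, not_forall,
        not_le]
      exact exists_nat_gt |x|
    rwa [h2, measure_empty] at h1
  rw [ENNReal.tendsto_atTop_zero]
  intro ε hε
  obtain ⟨η, hη0, hηε⟩ := exists_between hε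
  obtain ⟨K, hK⟩ := (htail.eventually_lt_const hη0).exists
  have hclosed : IsClosed {x : ℝ | (K : ℝ) ≤ |x|} := isClosed_le continuous_const continuous_abs
  have hport := ProbabilityMeasure.limsup_measure_closed_le_of_tendsto h.tendsto hclosed
  simp only [ProbabilityMeasure.coe_mk, Measure.map_id] at hport
  have hev := eventually_lt_of_limsup_lt (hport.trans_lt (hK.trans hηε))
  have hbig : Tendsto (fun n : ℕ => δ * √(n + 1)) atTop atTop :=
    (Real.tendsto_sqrt_atTop.comp
      (tendsto_natCast_atTop_atTop.atTop_add tendsto_const_nhds)).const_mul_atTop hδ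
  obtain ⟨N, hN⟩ := (hev.and (hbig.eventually_ge_atTop (K : ℝ))).exists_forall_of_atTop
  refine ⟨N, fun n hn => ?_⟩
  obtain ⟨h1, h2⟩ := hN n hn
  rw [Measure.map_apply_of_aemeasurable (h.forall_aemeasurable n) hclosed.measurableSet] at h1
  exact (measure_mono fun ω hω => h2.trans (le_of_lt hω)).trans h1.le

/-- The weak law of large numbers under the tilted measures. -/
theorem IsMarkovChain.tendsto_tiltedMeasure_lt_norm (hZ : IsMarkovChain P Z μ Q)
    (hQ : Q ∈ Matrix.rowStochastic ℝ L) (hirr : Q.IsIrreducible) (haper : IsAperiodic Q)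
    (hμ : μ ∈ stdSimplex ℝ L) (φ : L → Set.Ioi (0 : ℝ)) (g : L → ℂ) {ε : ℝ} (hε : 0 < ε) :
    Tendsto (fun n : ℕ => tiltedMeasure P Z φ n
      {ω | ε < ‖centeredSum (stationaryDist hQ) g Z n ω / (n + 1)‖}) atTop (𝓝 0) := by
  -- A complex number of modulus above ε has real or imaginary part above ε/2 in absolute value,
  -- hence two real cases and a union bound.
  have hre := tendsto_measure_mul_sqrt_lt_of_tendstoInDistribution
    (hZ.tendstoInDistribution hQ hirr haper hμ φ fun x => (g x).re) (half_pos hε)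
  have him := tendsto_measure_mul_sqrt_lt_of_tendstoInDistribution
    (hZ.tendstoInDistribution hQ hirr haper hμ φ fun x => (g x).im) (half_pos hε)
  have hsum := hre.add him
  rw [add_zero] at hsum
  refine tendsto_of_tendsto_of_tendsto_of_le_of_le tendsto_const_nhds hsum (fun n => zero_le)
    fun n => (measure_mono fun ω hω => ?_).trans (measure_union_le _ _)
  have hs : 0 < √((n : ℝ) + 1) := Real.sqrt_pos.2 (by positivity)
  have hsq : √((n : ℝ) + 1) * √((n : ℝ) + 1) = n + 1 := Real.mul_self_sqrt (by positivity)
  have hnorm : ‖((n : ℂ) + 1)‖ = (n : ℝ) + 1 := by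
    exact_mod_cast Complex.norm_natCast (n + 1)
  have ere : centeredSum (stationaryDist hQ) (fun x => (g x).re) Z n ω =
      (centeredSum (stationaryDist hQ) g Z n ω).re := by
    simp [centeredSum, centered, expect]
  have eim : centeredSum (stationaryDist hQ) (fun x => (g x).im) Z n ω =
      (centeredSum (stationaryDist hQ) g Z n ω).im := by
    simp [centeredSum, centered, expect]
  have hω' : ε * (n + 1) < ‖centeredSum (stationaryDist hQ) g Z n ω‖ := by
    have h1 : ε < ‖centeredSum (stationaryDist hQ) g Z n ω / (n + 1)‖ := hω
    rwa [norm_div, hnorm, lt_div_iff₀ (by positivity)] at h1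
  have htri := Complex.norm_le_abs_re_add_abs_im (centeredSum (stationaryDist hQ) g Z n ω)
  simp only [Set.mem_union, Set.mem_ofPred_eq, ere, eim, abs_div, abs_of_pos hs, lt_div_iff₀ hs,
    mul_assoc, hsq]
  by_contra! hcon
  linarith [hcon.1, hcon.2]

end Limit

end FiniteChain

theorem mainTheorem3 {L : Type*} [Fintype L] [DecidableEq L] [Nonempty L]
    [MeasurableSpace L] [MeasurableSingletonClass L]
    (Q : Matrix L L ℝ) (hQ : Q ∈ Matrix.rowStochastic ℝ L)
    (hirr : Q.IsIrreducible) (haper : FiniteChain.IsAperiodic Q)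
    (φ : L → Set.Ioi (0 : ℝ)) (μ : L → ℝ) (hμ : μ ∈ stdSimplex ℝ L)
    {Ω : Type*} [MeasurableSpace Ω] (P : Measure Ω) [IsProbabilityMeasure P]
    (Z : ℕ → Ω → L) (hZ : FiniteChain.IsMarkovChain P Z μ Q) :
    (∀ (g : L → ℂ) (ε : ℝ), 0 < ε →
      Tendsto (fun n : ℕ => FiniteChain.tiltedMeasure P Z φ n
          {ω | ε < ‖FiniteChain.centeredSum (FiniteChain.stationaryDist hQ) g Z n ω / (n + 1)‖})
        atTop (𝓝 0)) ∧
    (∀ g : L → ℝ,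
      0 ≤ FiniteChain.asymptoticVariance hQ g ∧
      TendstoInDistribution
        (fun (n : ℕ) (ω : Ω) =>
          FiniteChain.centeredSum (FiniteChain.stationaryDist hQ) g Z n ω / √(n + 1))
        atTop (id : ℝ → ℝ) (fun n => FiniteChain.tiltedMeasure P Z φ n)
        (gaussianReal 0 (FiniteChain.asymptoticVariance hQ g).toNNReal)) := by
  refine ⟨fun g ε hε => hZ.tendsto_tiltedMeasure_lt_norm hQ hirr haper hμ φ g hε, fun g => ?_⟩
  exact ⟨FiniteChain.asymptoticVariance_nonneg hQ hirr g,
    hZ.tendstoInDistribution hQ hirr haper hμ φ g⟩
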